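/- There is an absolute constant $C>0$ such that the following holds. Let $N,d\ge 1$ be integers and let $\epsilon>0$. Then there is an integer $M_0\le C\,\sqrt N\,d/\epsilon^2$ such that for every probability vector $(p_1,\dots,p_N)$ with all $p_i>0$ and every integer $M\ge M_0$ there is a two-outcome measurement $\{E_{\mathrm{accept}},E_{\mathrm{reject}}\}$ on $(\mathbb C^N\otimes\mathbb C^d)^{\otimes M}$ (positive semidefinite operators with $E_{\mathrm{accept}}+E_{\mathrm{reject}}=I$), depending only on $N,d,\epsilon,p$ and $M$, with the following property. For every collection $\rho_1,\dots,\rho_N$ of density matrices on $\mathbb C^d$, with sampling state $\rho=\sum_{i=1}^N p_i|i\rangle\langle i|\otimes\rho_i$: (A) if $\rho_1=\rho_2=\dots=\rho_N$, then $\mathrm{Tr}[E_{\mathrm{accept}}\,\rho^{\otimes M}]>2/3$; (B) if $\sum_{i=1}^N p_i D_{\mathrm{Tr}}(\rho_i,\sigma)>\epsilon$ for every density matrix $\sigma$ on $\mathbb C^d$, then $\mathrm{Tr}[E_{\mathrm{accept}}\,\rho^{\otimes M}]<1/3$. Here $D_{\mathrm{Tr}}(\rho,\sigma)=\frac12\|\rho-\sigma\|_1$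 with $\|A\|_1=\mathrm{Tr}\sqrt{A^\dagger A}$. -/

import Mathlib

open scoped Kronecker ComplexOrder

noncomputable section

/-- A density matrix (quantum state) on `ℂ^n`: positive semidefinite with unit trace. -/
structure IsDensityMatrix {n : Type*} [Fintype n] (ρ : Matrix n n ℂ) : Prop where
  posSemidef : ρ.PosSemidef
  trace_eq_one : ρ.trace = 1

/-- The Schatten 1-norm `‖A‖₁ = Tr √(A†A)`: the sum of the square roots of the eigenvalues of
the positive semidefinite matrix `A†A`, with multiplicity (the singular values of `A`). -/
def traceNorm {n : Type*} [Fintype n] [DecidableEq n] (A : Matrix n n ℂ) : ℝ :=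
  ∑ k, √((Matrix.isHermitian_conjTranspose_mul_self A).eigenvalues k)

/-- The trace distance `D_Tr(ρ, σ) = ‖ρ - σ‖₁ / 2`. -/
def traceDist {n : Type*} [Fintype n] [DecidableEq n] (ρ σ : Matrix n n ℂ) : ℝ :=
  traceNorm (ρ - σ) / 2

/-- The classical-quantum sampling state `∑ i, p i |i⟩⟨i| ⊗ ρ i` on `ℂ^N ⊗ ℂ^d`. -/
def samplingState {N d : ℕ} (p : Fin N → ℝ) (ρ : Fin N → Matrix (Fin d) (Fin d) ℂ) :
    Matrix (Fin N × Fin d) (Fin N × Fin d) ℂ :=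
  ∑ i, (p i : ℂ) • (Matrix.single i i (1 : ℂ) ⊗ₖ ρ i)

/-- The `M`-fold tensor power `A^{⊗M}` on `(ℂ^n)^{⊗M}`, in the product basis, which is indexed
by `Fin M → n`. -/
def tensorPower {n : Type*} (M : ℕ) (A : Matrix n n ℂ) :
    Matrix (Fin M → n) (Fin M → n) ℂ :=
  Matrix.of fun a b => ∏ k, A (a k) (b k)

/-- A two-outcome measurement (POVM) on `ℂ^n`, with outcomes "accept" and "reject". -/
structure TwoOutcomePOVM (n : Type*) [Fintype n] [DecidableEq n] where
  accept : Matrix n n ℂ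
  reject : Matrix n n ℂ
  accept_posSemidef : accept.PosSemidef
  reject_posSemidef : reject.PosSemidef
  accept_add_reject : accept + reject = 1

/-- The probability `Tr[E_accept τ]` of the outcome "accept" on the state `τ`. -/
def TwoOutcomePOVM.acceptProb {n : Type*} [Fintype n] [DecidableEq n]
    (T : TwoOutcomePOVM n) (τ : Matrix n n ℂ) : ℝ :=
  (T.accept * τ).trace.re

/-- Case A: all the states of the collection are equal. -/
def CaseA {N d : ℕ} (ρ : Fin N → Matrix (Fin d) (Fin d) ℂ) : Prop :=
  ∀ i j, ρ i = ρ j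

/-- Case B: `∑ i, p i D_Tr(ρ i, σ) > ε` for every state `σ`. -/
def CaseB {N d : ℕ} (p : Fin N → ℝ) (ε : ℝ) (ρ : Fin N → Matrix (Fin d) (Fin d) ℂ) : Prop :=
  ∀ σ : Matrix (Fin d) (Fin d) ℂ, IsDensityMatrix σ → ε < ∑ i, p i * traceDist (ρ i) σ

end

open scoped Kronecker ComplexOrder

open Matrix

/-! The test estimates the mean squared Hilbert–Schmidt deviation `spread` of the `ρ i` from their
average. The spread vanishes in Case A. In Case B, Jensen and `‖A‖₁² ≤ d ‖A‖₂²`, applied with `σ`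
the average state, force it above `4ε²/d` (`CaseB.lt_mul_spread`).

The estimator sums, over ordered pairs of distinct copies, a SWAP weighted by the kernel `δ i j / p
i - 1` in the classical registers. Each term has mean `spread`. In the second moment, disjoint pairs
factorise, coinciding pairs contribute at most `∑ p i p j g i j² = N - 1` whatever `p` is, and pairs
sharing one copy contribute at most `spread`. The variance is therefore at most `2NM² + 4M³ spread`
(`trace_swapStatistic_sq_mul_le`), against a mean of order `M² spread`.

Measuring the estimator and thresholding halfway, at `2ε²/d` per pair, succeeds by Chebyshev once
`M` is a large multiple of `√N d/ε²`. -/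

/-- The tensor product `⨂ k, A k` of a family of matrices, in the product basis. -/
def productMatrix {ι n R : Type*} [Fintype ι] [CommSemiring R] (A : ι → Matrix n n R) :
    Matrix (ι → n) (ι → n) R :=
  Matrix.of fun a b => ∏ k, A k (a k) (b k)

open scoped MatrixOrder in
theorem Matrix.PosSemidef.exists_eq_conjTranspose_mul_self {n : Type*} [Fintype n]
    {A : Matrix n n ℂ} (hA : A.PosSemidef) : ∃ B : Matrix n n ℂ, A = Bᴴ * B := by
  classical
  exact CStarAlgebra.nonneg_iff_eq_star_mul_self.mp hA.nonneg

/-! ### Tensor products of matrices and their traces. -/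

section ProductMatrix

variable {ι n : Type*} [Fintype ι] [Fintype n]

theorem productMatrix_mul [DecidableEq ι] (A B : ι → Matrix n n ℂ) :
    productMatrix A * productMatrix B = productMatrix fun k => A k * B k := by
  ext a b
  simp only [productMatrix, mul_apply, of_apply, ← Finset.prod_mul_distrib]
  rw [Finset.prod_univ_sum, Fintype.piFinset_univ]

theorem trace_productMatrix [DecidableEq ι] (A : ι → Matrix n n ℂ) :
    (productMatrix A).trace = ∏ k, (A k).trace := by
  simp only [productMatrix, trace, diag_apply, of_apply]
  rw [Finset.prod_univ_sum, Fintype.piFinset_univ]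

omit [Fintype n] in
theorem conjTranspose_productMatrix (A : ι → Matrix n n ℂ) :
    (productMatrix A)ᴴ = productMatrix fun k => (A k)ᴴ := by
  ext a b
  simp [productMatrix, conjTranspose_apply]

theorem trace_productMatrix_mul_tensorPower {M : ℕ} (A : Fin M → Matrix n n ℂ)
    (τ : Matrix n n ℂ) :
    (productMatrix A * tensorPower M τ).trace = ∏ k, (A k * τ).trace := by
  rw [← trace_productMatrix, ← productMatrix_mul]
  rfl

theorem IsDensityMatrix.tensorPower {τ : Matrix n n ℂ} (h : IsDensityMatrix τ) (M : ℕ) :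
    IsDensityMatrix (tensorPower M τ) := by
  classical
  constructor
  · obtain ⟨B, hB⟩ := h.posSemidef.exists_eq_conjTranspose_mul_self
    have : _root_.tensorPower M τ
        = (productMatrix fun _ : Fin M => B)ᴴ * productMatrix fun _ : Fin M => B := by
      rw [conjTranspose_productMatrix, productMatrix_mul]
      subst hB
      rfl
    rw [this]
    exact posSemidef_conjTranspose_mul_self _
  · have := trace_productMatrix (fun _ : Fin M => τ)
    rw [h.trace_eq_one, Finset.prod_const_one] at this
    exact this

end ProductMatrix

/-! ### Spectral measurement of an observable and Chebyshev bounds for thresholding. -/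

section Chebyshev

variable {n : Type*} [Fintype n] [DecidableEq n]

/-- The spectral calculus `∑ k, f (λ k) |v k⟩⟨v k|` of a Hermitian matrix. -/
noncomputable def spectralFun {O : Matrix n n ℂ} (hO : O.IsHermitian) (f : ℝ → ℝ) : Matrix n n ℂ :=
  (hO.eigenvectorUnitary : Matrix n n ℂ) * diagonal (fun k => (f (hO.eigenvalues k) : ℂ)) *
    (hO.eigenvectorUnitary : Matrix n n ℂ)ᴴ

/-- The distribution of the spectral measurement of a Hermitian matrix on the state `τ`. -/
noncomputable def spectralWeight {O : Matrix n n ℂ} (hO : O.IsHermitian) (τ : Matrix n n ℂ) (k : n) : ℝ :=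
  (((hO.eigenvectorUnitary : Matrix n n ℂ)ᴴ * τ * (hO.eigenvectorUnitary : Matrix n n ℂ)) k k).re

variable {O : Matrix n n ℂ} (hO : O.IsHermitian)

theorem conjTranspose_eigenvectorUnitary_mul_self :
    (hO.eigenvectorUnitary : Matrix n n ℂ)ᴴ * (hO.eigenvectorUnitary : Matrix n n ℂ) = 1 :=
  mem_unitaryGroup_iff'.mp hO.eigenvectorUnitary.2

theorem spectralFun_id : spectralFun hO (fun x => x) = O := by
  conv_rhs => rw [hO.spectral_theorem, Unitary.conjStarAlgAut_apply]
  rfl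

theorem spectralFun_mul (f g : ℝ → ℝ) :
    spectralFun hO f * spectralFun hO g = spectralFun hO (fun x => f x * g x) := by
  simp only [spectralFun, Matrix.mul_assoc]
  rw [← Matrix.mul_assoc _ᴴ, conjTranspose_eigenvectorUnitary_mul_self, Matrix.one_mul,
    ← Matrix.mul_assoc (diagonal _), diagonal_mul_diagonal]
  simp

theorem spectralFun_one : spectralFun hO (fun _ => 1) = 1 := by
  simp only [spectralFun, Complex.ofReal_one, diagonal_one, Matrix.mul_one]
  exact mem_unitaryGroup_iff.mp hO.eigenvectorUnitary.2

theorem spectralFun_add (f g : ℝ → ℝ) :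
    spectralFun hO f + spectralFun hO g = spectralFun hO (fun x => f x + g x) := by
  simp only [spectralFun, Complex.ofReal_add]
  rw [← diagonal_add, Matrix.mul_add, Matrix.add_mul]

theorem posSemidef_spectralFun {f : ℝ → ℝ} (hf : ∀ x, 0 ≤ f x) :
    (spectralFun hO f).PosSemidef :=
  PosSemidef.mul_mul_conjTranspose_same
    (PosSemidef.diagonal fun k => by simpa using hf _) _

theorem trace_spectralFun_mul (f : ℝ → ℝ) (τ : Matrix n n ℂ) :
    (spectralFun hO f * τ).trace.re = ∑ k, f (hO.eigenvalues k) * spectralWeight hO τ k := by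
  rw [spectralFun, Matrix.mul_assoc, Matrix.mul_assoc, Matrix.trace_mul_comm, Matrix.mul_assoc]
  simp only [trace, diag_apply, diagonal_mul, Complex.re_sum, Complex.re_ofReal_mul,
    spectralWeight]

theorem spectralWeight_nonneg {τ : Matrix n n ℂ} (hτ : τ.PosSemidef) (k : n) :
    0 ≤ spectralWeight hO τ k :=
  (Complex.nonneg_iff.mp ((hτ.conjTranspose_mul_mul_same _).diag_nonneg (i := k))).1

/-- Accept when the measured eigenvalue of `O` is at most `θ`. -/
noncomputable def thresholdPOVM (θ : ℝ) : TwoOutcomePOVM n where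
  accept := spectralFun hO fun x => if x ≤ θ then 1 else 0
  reject := spectralFun hO fun x => if x ≤ θ then 0 else 1
  accept_posSemidef := posSemidef_spectralFun hO fun x => by split_ifs <;> norm_num
  reject_posSemidef := posSemidef_spectralFun hO fun x => by split_ifs <;> norm_num
  accept_add_reject := by
    rw [spectralFun_add, ← spectralFun_one hO]
    congr 1
    ext x
    split_ifs <;> norm_num

variable {τ : Matrix n n ℂ}

theorem sum_spectralWeight (hτ : IsDensityMatrix τ) : ∑ k, spectralWeight hO τ k = 1 := by
  have := trace_spectralFun_mul hO (fun _ => 1) τ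
  rw [spectralFun_one, Matrix.one_mul, hτ.trace_eq_one] at this
  simpa using this.symm

theorem sum_eigenvalues_mul_spectralWeight :
    ∑ k, hO.eigenvalues k * spectralWeight hO τ k = (O * τ).trace.re := by
  rw [← trace_spectralFun_mul hO (fun x => x), spectralFun_id]

theorem sum_sq_eigenvalues_mul_spectralWeight :
    ∑ k, hO.eigenvalues k ^ 2 * spectralWeight hO τ k = (O * O * τ).trace.re := by
  rw [← trace_spectralFun_mul hO (fun x => x ^ 2)]
  conv_rhs => rw [← spectralFun_id hO, spectralFun_mul]
  simp only [sq]

/-- Markov's inequality for the squared outcome: a rejected eigenvalue exceeds `θ ≥ 0`, so its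
square is at least `θ²`. No centring is needed, since this serves Case A, where the mean is zero. -/
theorem one_sub_acceptProb_thresholdPOVM_le (hτ : IsDensityMatrix τ) {θ : ℝ} (hθ : 0 ≤ θ) :
    (1 - (thresholdPOVM hO θ).acceptProb τ) * θ ^ 2 ≤ (O * O * τ).trace.re := by
  rw [← sum_spectralWeight hO hτ, TwoOutcomePOVM.acceptProb, thresholdPOVM,
    trace_spectralFun_mul, ← sum_sq_eigenvalues_mul_spectralWeight hO, ← Finset.sum_sub_distrib,
    Finset.sum_mul]
  refine Finset.sum_le_sum fun k _ => ?_
  have hw := spectralWeight_nonneg hO hτ.posSemidef k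
  split_ifs with h
  · have := mul_nonneg (sq_nonneg (hO.eigenvalues k)) hw
    linarith
  · have : θ ^ 2 ≤ hO.eigenvalues k ^ 2 := pow_le_pow_left₀ hθ (not_le.mp h).le 2
    nlinarith

/-- Chebyshev's inequality around the mean: an accepted eigenvalue lies at least `μ - θ` below `μ`.
-/
theorem acceptProb_thresholdPOVM_mul_le (hτ : IsDensityMatrix τ) {θ μ : ℝ} (hθ : θ ≤ μ)
    (hμ : (O * τ).trace.re = μ) :
    (thresholdPOVM hO θ).acceptProb τ * (μ - θ) ^ 2 ≤ (O * O * τ).trace.re - μ ^ 2 := by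
  have key : (O * O * τ).trace.re - μ ^ 2
      = ∑ k, (hO.eigenvalues k - μ) ^ 2 * spectralWeight hO τ k := by
    have : ∀ k, (hO.eigenvalues k - μ) ^ 2 * spectralWeight hO τ k
        = hO.eigenvalues k ^ 2 * spectralWeight hO τ k
          - 2 * μ * (hO.eigenvalues k * spectralWeight hO τ k)
          + μ ^ 2 * spectralWeight hO τ k := fun k => by ring
    simp only [this, Finset.sum_add_distrib, Finset.sum_sub_distrib, ← Finset.mul_sum]
    rw [sum_sq_eigenvalues_mul_spectralWeight, sum_eigenvalues_mul_spectralWeight,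
      sum_spectralWeight hO hτ, hμ]
    ring
  rw [key, TwoOutcomePOVM.acceptProb, thresholdPOVM, trace_spectralFun_mul, Finset.sum_mul]
  refine Finset.sum_le_sum fun k _ => ?_
  have hw := spectralWeight_nonneg hO hτ.posSemidef k
  split_ifs with h
  · have : (μ - θ) ^ 2 ≤ (hO.eigenvalues k - μ) ^ 2 := by nlinarith
    nlinarith
  · have := mul_nonneg (sq_nonneg (hO.eigenvalues k - μ)) hw
    linarith

end Chebyshev

/-! ### Hilbert–Schmidt norm estimates. -/

section HilbertSchmidt

variable {n : Type*} [Fintype n] [DecidableEq n]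

omit [DecidableEq n] in
theorem trace_conjTranspose_mul_self_re (A : Matrix n n ℂ) :
    (Aᴴ * A).trace.re = ∑ i, ∑ j, ‖A i j‖ ^ 2 := by
  simp only [trace, diag_apply, mul_apply, conjTranspose_apply, Complex.re_sum]
  rw [Finset.sum_comm]
  refine Finset.sum_congr rfl fun i _ => Finset.sum_congr rfl fun j _ => ?_
  rw [← Complex.normSq_eq_norm_sq, Complex.star_def, ← Complex.normSq_eq_conj_mul_self,
    Complex.ofReal_re]

omit [DecidableEq n] in
/-- Submultiplicativity of the (squared) Hilbert–Schmidt norm. -/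
theorem trace_conjTranspose_mul_self_mul_le (A B : Matrix n n ℂ) :
    ((A * B)ᴴ * (A * B)).trace.re ≤ (Aᴴ * A).trace.re * (Bᴴ * B).trace.re := by
  simp only [trace_conjTranspose_mul_self_re]
  have h : ∀ i j, ‖(A * B) i j‖ ^ 2 ≤ (∑ k, ‖A i k‖ ^ 2) * ∑ k, ‖B k j‖ ^ 2 := fun i j => by
    rw [mul_apply]
    calc ‖∑ k, A i k * B k j‖ ^ 2 ≤ (∑ k, ‖A i k‖ * ‖B k j‖) ^ 2 := by
          gcongr
          exact (norm_sum_le _ _).trans (by simp)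
      _ ≤ _ := Finset.sum_mul_sq_le_sq_mul_sq _ _ _
  calc ∑ i, ∑ j, ‖(A * B) i j‖ ^ 2
      ≤ ∑ i, ∑ j, (∑ k, ‖A i k‖ ^ 2) * ∑ k, ‖B k j‖ ^ 2 :=
        Finset.sum_le_sum fun i _ => Finset.sum_le_sum fun j _ => h i j
    _ = _ := by
      rw [Finset.sum_comm (f := fun k j => ‖B k j‖ ^ 2), Finset.sum_mul_sum]

omit [DecidableEq n] in
-- Writing `ρ = Bᴴ B`, the left side is `‖B Δ‖₂²` and `‖B‖₂² = Tr ρ = 1`. This controls the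
-- covariance of two swaps sharing one copy.
theorem IsDensityMatrix.trace_mul_sq_le {ρ Δ : Matrix n n ℂ} (hρ : IsDensityMatrix ρ)
    (hΔ : Δ.IsHermitian) : (ρ * Δ * Δ).trace.re ≤ (Δ * Δ).trace.re := by
  obtain ⟨B, hB⟩ := hρ.posSemidef.exists_eq_conjTranspose_mul_self
  have h := trace_conjTranspose_mul_self_mul_le B Δ
  have h1 : (Bᴴ * B).trace = 1 := by rw [← hρ.trace_eq_one, hB]
  rw [h1, conjTranspose_mul, hΔ.eq, Complex.one_re, one_mul] at h
  refine le_trans (le_of_eq ?_) h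
  rw [hB, trace_mul_comm]
  simp only [Matrix.mul_assoc]

omit [DecidableEq n] in
theorem IsDensityMatrix.trace_mul_self_le_one {ρ : Matrix n n ℂ} (hρ : IsDensityMatrix ρ) :
    (ρ * ρ).trace.re ≤ 1 := by
  obtain ⟨B, hB⟩ := hρ.posSemidef.exists_eq_conjTranspose_mul_self
  have h := trace_conjTranspose_mul_self_mul_le B Bᴴ
  have h1 : (Bᴴ * B).trace = 1 := by rw [← hρ.trace_eq_one, hB]
  have h2 : (B * Bᴴ).trace = 1 := by rw [trace_mul_comm, h1]
  rw [conjTranspose_conjTranspose, h1, h2, Complex.one_re, one_mul] at h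
  refine le_trans (le_of_eq ?_) h
  rw [hB, conjTranspose_mul, conjTranspose_conjTranspose, Matrix.mul_assoc, trace_mul_comm]
  simp only [Matrix.mul_assoc]

/-- Cauchy–Schwarz on the singular values. This is the source of the factor `d` in the sample size.
-/
theorem traceNorm_sq_le (A : Matrix n n ℂ) :
    traceNorm A ^ 2 ≤ Fintype.card n * (Aᴴ * A).trace.re := by
  have h := isHermitian_conjTranspose_mul_self A
  have htr : (Aᴴ * A).trace.re = ∑ k, √(h.eigenvalues k) ^ 2 := by
    rw [h.trace_eq_sum_eigenvalues, Complex.re_sum]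
    refine Finset.sum_congr rfl fun k _ => ?_
    rw [Real.sq_sqrt ((posSemidef_conjTranspose_mul_self A).eigenvalues_nonneg k)]
    rfl
  rw [htr]
  exact sq_sum_le_card_mul_sum_sq

end HilbertSchmidt

/-! ### Operators on two tensor factors and their moments. -/

section PairMatrix

variable {ι n : Type*} [Fintype ι] [DecidableEq ι] [Fintype n] [DecidableEq n]

/-- The operator acting as `A` on the factor `k`, as `B` on the factor `l`, and trivially on the
other factors. -/
def pairMatrix (k l : ι) (A B : Matrix n n ℂ) : Matrix (ι → n) (ι → n) ℂ :=
  productMatrix fun m => (if m = k then A else 1) * if m = l then B else 1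

theorem pairMatrix_comm {k l : ι} (hkl : k ≠ l) (A B : Matrix n n ℂ) :
    pairMatrix k l A B = pairMatrix l k B A := by
  unfold pairMatrix
  congr 1
  ext1 m
  split_ifs with h1 h2 <;> simp_all

theorem conjTranspose_pairMatrix {k l : ι} (hkl : k ≠ l) (A B : Matrix n n ℂ) :
    (pairMatrix k l A B)ᴴ = pairMatrix k l Aᴴ Bᴴ := by
  unfold pairMatrix
  rw [conjTranspose_productMatrix]
  congr 1
  ext1 m
  split_ifs with h1 h2 <;> simp_all

variable {M : ℕ} {τ : Matrix n n ℂ} {k l k' l' : Fin M}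

/-- The trace factorises over the copies, and each untouched copy contributes `Tr τ = 1`. -/
theorem trace_pairMatrix_mul_tensorPower (hτ : τ.trace = 1) (hkl : k ≠ l) (A B : Matrix n n ℂ) :
    (pairMatrix k l A B * tensorPower M τ).trace = (A * τ).trace * (B * τ).trace := by
  rw [pairMatrix, trace_productMatrix_mul_tensorPower]
  have : ∀ m, (((if m = k then A else 1) * if m = l then B else 1) * τ).trace
      = (if m = k then (A * τ).trace else 1) * if m = l then (B * τ).trace else 1 := by
    intro m
    split_ifs <;> simp_all
  simp only [this, Finset.prod_mul_distrib, Finset.prod_ite_eq', Finset.mem_univ, if_true]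

theorem trace_pairMatrix_mul_pairMatrix_same (hτ : τ.trace = 1) (hkl : k ≠ l)
    (A B A' B' : Matrix n n ℂ) :
    (pairMatrix k l A B * pairMatrix k l A' B' * tensorPower M τ).trace
      = (A * A' * τ).trace * (B * B' * τ).trace := by
  rw [← trace_pairMatrix_mul_tensorPower hτ hkl]
  congr 2
  rw [pairMatrix, pairMatrix, pairMatrix, productMatrix_mul]
  congr 1
  ext1 m
  split_ifs <;> simp_all

theorem trace_pairMatrix_mul_pairMatrix_left (hτ : τ.trace = 1) (hkl : k ≠ l) (hkl' : k ≠ l')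
    (hll' : l ≠ l') (A B A' B' : Matrix n n ℂ) :
    (pairMatrix k l A B * pairMatrix k l' A' B' * tensorPower M τ).trace
      = (A * A' * τ).trace * (B * τ).trace * (B' * τ).trace := by
  rw [pairMatrix, pairMatrix, productMatrix_mul, trace_productMatrix_mul_tensorPower]
  have : ∀ m, (((if m = k then A else 1) * if m = l then B else 1)
        * ((if m = k then A' else 1) * if m = l' then B' else 1) * τ).trace
      = (if m = k then (A * A' * τ).trace else 1) * (if m = l then (B * τ).trace else 1)
        * if m = l' then (B' * τ).trace else 1 := by
    intro m
    split_ifs <;> simp_all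
  simp only [this, Finset.prod_mul_distrib, Finset.prod_ite_eq', Finset.mem_univ, if_true]

theorem trace_pairMatrix_mul_pairMatrix_disjoint (hτ : τ.trace = 1) (hkl : k ≠ l)
    (hkl' : k' ≠ l') (h1 : k ≠ k') (h2 : k ≠ l') (h3 : l ≠ k') (h4 : l ≠ l')
    (A B A' B' : Matrix n n ℂ) :
    (pairMatrix k l A B * pairMatrix k' l' A' B' * tensorPower M τ).trace
      = (A * τ).trace * (B * τ).trace * ((A' * τ).trace * (B' * τ).trace) := by
  rw [pairMatrix, pairMatrix, productMatrix_mul, trace_productMatrix_mul_tensorPower]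
  have : ∀ m, (((if m = k then A else 1) * if m = l then B else 1)
        * ((if m = k' then A' else 1) * if m = l' then B' else 1) * τ).trace
      = (if m = k then (A * τ).trace else 1) * (if m = l then (B * τ).trace else 1)
        * ((if m = k' then (A' * τ).trace else 1) * if m = l' then (B' * τ).trace else 1) := by
    intro m
    split_ifs <;> simp_all
  simp only [this, Finset.prod_mul_distrib, Finset.prod_ite_eq', Finset.mem_univ, if_true]

end PairMatrix

/-! ### The sampling state is a block-diagonal density matrix. -/

section SamplingState

variable {N d : ℕ} {p : Fin N → ℝ} {ρ : Fin N → Matrix (Fin d) (Fin d) ℂ}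

theorem samplingState_apply (i j : Fin N) (a b : Fin d) :
    samplingState p ρ (i, a) (j, b) = if i = j then p i * ρ i a b else 0 := by
  simp only [samplingState, Matrix.sum_apply, Matrix.smul_apply, kroneckerMap_apply, single_apply, smul_eq_mul]
  split_ifs with h
  · subst h
    rw [Finset.sum_eq_single i] <;> simp +contextual
  · refine Finset.sum_eq_zero fun k _ => ?_
    rw [if_neg (by rintro ⟨rfl, rfl⟩; exact h rfl)]
    simp

theorem isDensityMatrix_samplingState (hp : ∀ i, 0 < p i) (hsum : ∑ i, p i = 1)
    (hρ : ∀ i, IsDensityMatrix (ρ i)) : IsDensityMatrix (samplingState p ρ) := by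
  constructor
  · refine posSemidef_sum _ fun i _ => PosSemidef.smul (PosSemidef.kronecker ?_ (hρ i).posSemidef) ?_
    · rw [← diagonal_single]
      exact PosSemidef.diagonal (Pi.single_nonneg.mpr zero_le_one)
    · exact_mod_cast (hp i).le
  · simp only [samplingState, trace_sum, trace_smul, trace_kronecker, (hρ _).trace_eq_one,
      trace_single_eq_same, mul_one, smul_eq_mul]
    exact_mod_cast hsum

end SamplingState

/-! ### Weighted swaps and their first and second moments. -/

section CollisionSwap

variable {N d : ℕ}

/-- The operator `|i⟩⟨i| ⊗ |a⟩⟨b|`. -/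
def blockUnit (i : Fin N) (a b : Fin d) : Matrix (Fin N × Fin d) (Fin N × Fin d) ℂ :=
  single (i, a) (i, b) 1

theorem conjTranspose_blockUnit (i : Fin N) (a b : Fin d) :
    (blockUnit i a b)ᴴ = blockUnit i b a := by
  simp [blockUnit]

theorem trace_blockUnit_mul_samplingState (p : Fin N → ℝ)
    (ρ : Fin N → Matrix (Fin d) (Fin d) ℂ) (i : Fin N) (a b : Fin d) :
    (blockUnit i a b * samplingState p ρ).trace = p i * ρ i b a := by
  rw [blockUnit, trace_single_mul, samplingState_apply]
  simp

theorem blockUnit_mul_blockUnit (i j : Fin N) (a b c e : Fin d) :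
    blockUnit i a b * blockUnit j c e = if i = j ∧ b = c then blockUnit i a e else 0 := by
  unfold blockUnit
  split_ifs with h
  · obtain ⟨rfl, rfl⟩ := h
    simp
  · exact single_mul_single_of_ne _ _ _ _ (by simpa using h) _

variable {M : ℕ}

/-- The operator `∑ i j, g i j |i j⟩⟨i j| ⊗ SWAP` on the factors `k` and `l`. -/
def weightedSwap (g : Fin N → Fin N → ℝ) (k l : Fin M) :
    Matrix (Fin M → Fin N × Fin d) (Fin M → Fin N × Fin d) ℂ :=
  ∑ i, ∑ j, ∑ a, ∑ b, (g i j : ℂ) • pairMatrix k l (blockUnit i a b) (blockUnit j b a)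

variable {g : Fin N → Fin N → ℝ}

theorem weightedSwap_comm (hg : ∀ i j, g i j = g j i) {k l : Fin M} (hkl : k ≠ l) :
    (weightedSwap g k l : Matrix (Fin M → Fin N × Fin d) _ ℂ) = weightedSwap g l k := by
  unfold weightedSwap
  rw [Finset.sum_comm]
  refine Finset.sum_congr rfl fun i _ => Finset.sum_congr rfl fun j _ => ?_
  rw [Finset.sum_comm]
  refine Finset.sum_congr rfl fun a _ => Finset.sum_congr rfl fun b _ => ?_
  rw [hg, pairMatrix_comm hkl]

theorem isHermitian_weightedSwap {k l : Fin M} (hkl : k ≠ l) :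
    (weightedSwap g k l : Matrix (Fin M → Fin N × Fin d) _ ℂ).IsHermitian := by
  unfold IsHermitian weightedSwap
  simp only [conjTranspose_sum, conjTranspose_smul, conjTranspose_pairMatrix hkl,
    conjTranspose_blockUnit]
  refine Finset.sum_congr rfl fun i _ => Finset.sum_congr rfl fun j _ => ?_
  rw [Finset.sum_comm]
  simp

variable {p : Fin N → ℝ} {ρ : Fin N → Matrix (Fin d) (Fin d) ℂ}

/-- The `g`-weighted combination `∑ j, p j g i j ρ j` of the states of a collection. -/
def weightedState (p : Fin N → ℝ) (g : Fin N → Fin N → ℝ)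
    (ρ : Fin N → Matrix (Fin d) (Fin d) ℂ) (i : Fin N) : Matrix (Fin d) (Fin d) ℂ :=
  ∑ j, ((p j * g i j : ℝ) : ℂ) • ρ j

theorem weightedState_apply (p : Fin N → ℝ) (g : Fin N → Fin N → ℝ)
    (ρ : Fin N → Matrix (Fin d) (Fin d) ℂ) (i : Fin N) (a b : Fin d) :
    weightedState p g ρ i a b = ∑ j, ((p j * g i j : ℝ) : ℂ) * ρ j a b := by
  simp [weightedState, Matrix.sum_apply]

variable {k l k' l' : Fin M}

/-- The swap trick `Tr[SWAP (A ⊗ B)] = Tr[A B]`, block by block; summing over the second register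
collects the weights into `weightedState`. -/
theorem trace_weightedSwap_mul (hτ : (samplingState p ρ).trace = 1) (hkl : k ≠ l) :
    (weightedSwap g k l * tensorPower M (samplingState p ρ)).trace
      = ∑ i, (p i : ℂ) * (ρ i * weightedState p g ρ i).trace := by
  simp only [weightedSwap, Matrix.sum_mul, trace_sum, smul_mul, trace_smul, smul_eq_mul,
    trace_pairMatrix_mul_tensorPower hτ hkl, trace_blockUnit_mul_samplingState]
  refine Finset.sum_congr rfl fun i _ => ?_
  simp only [weightedState, trace_sum, Matrix.mul_smul, trace_smul, smul_eq_mul,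
    Finset.mul_sum]
  refine Finset.sum_congr rfl fun j _ => ?_
  rw [Finset.sum_comm]
  simp only [trace, diag_apply, mul_apply, Finset.mul_sum]
  refine Finset.sum_congr rfl fun a _ => Finset.sum_congr rfl fun b _ => ?_
  push_cast
  ring

theorem trace_weightedSwap_mul_weightedSwap_disjoint (hτ : (samplingState p ρ).trace = 1)
    (hkl : k ≠ l) (hkl' : k' ≠ l') (h1 : k ≠ k') (h2 : k ≠ l') (h3 : l ≠ k') (h4 : l ≠ l') :
    (weightedSwap g k l * weightedSwap g k' l' * tensorPower M (samplingState p ρ)).trace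
      = (weightedSwap g k l * tensorPower M (samplingState p ρ)).trace
        * (weightedSwap g k' l' * tensorPower M (samplingState p ρ)).trace := by
  simp only [weightedSwap, Matrix.sum_mul, Matrix.mul_sum, trace_sum, Matrix.smul_mul,
    Matrix.mul_smul, trace_smul, smul_eq_mul, trace_pairMatrix_mul_tensorPower hτ hkl,
    trace_pairMatrix_mul_tensorPower hτ hkl',
    trace_pairMatrix_mul_pairMatrix_disjoint hτ hkl hkl' h1 h2 h3 h4]
  simp only [Finset.sum_mul, Finset.mul_sum]
  congr! 8
  ring

/-- Since `SWAP² = 1`, the quantum part drops out and only the classical second moment of `g`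
remains. -/
theorem trace_weightedSwap_mul_weightedSwap_same (hτ : (samplingState p ρ).trace = 1)
    (hρ : ∀ i, (ρ i).trace = 1) (hkl : k ≠ l) :
    (weightedSwap g k l * weightedSwap g k l * tensorPower M (samplingState p ρ)).trace
      = ∑ i, ∑ j, ((p i * p j * g i j ^ 2 : ℝ) : ℂ) := by
  simp only [weightedSwap, Matrix.sum_mul, Matrix.mul_sum, trace_sum, Matrix.smul_mul,
    Matrix.mul_smul, trace_smul, smul_eq_mul,
    trace_pairMatrix_mul_pairMatrix_same hτ hkl, blockUnit_mul_blockUnit, ite_and, ite_mul, mul_ite,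
    apply_ite trace, trace_blockUnit_mul_samplingState, trace_zero, zero_mul,
    mul_zero, Finset.sum_ite_eq', Finset.mem_univ, if_true, Finset.sum_ite_irrel,
    Finset.sum_const_zero]
  refine Finset.sum_congr rfl fun i _ => Finset.sum_congr rfl fun j _ => ?_
  have : ((p i * p j * g i j ^ 2 : ℝ) : ℂ)
      = (g i j * g i j * p i * p j) * ((ρ j).trace * (ρ i).trace) := by
    rw [hρ, hρ]
    push_cast
    ring
  rw [this, trace, trace, Finset.sum_mul_sum, Finset.mul_sum]
  refine Finset.sum_congr rfl fun a _ => ?_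
  rw [Finset.mul_sum]
  refine Finset.sum_congr rfl fun b _ => ?_
  simp only [diag_apply]
  ring

/-- Two swaps sharing one copy compose to a 3-cycle, whose expectation is the trace of a triple
product. The shared register forces the same `i` in both swaps, and the other two registers are
averaged independently. -/
theorem trace_weightedSwap_mul_weightedSwap_left (hτ : (samplingState p ρ).trace = 1)
    (hkl : k ≠ l) (hkl' : k ≠ l') (hll' : l ≠ l') :
    (weightedSwap g k l * weightedSwap g k l' * tensorPower M (samplingState p ρ)).trace
      = ∑ i, (p i : ℂ) * (ρ i * weightedState p g ρ i * weightedState p g ρ i).trace := by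
  simp only [weightedSwap, Matrix.sum_mul, Matrix.mul_sum, trace_sum, Matrix.smul_mul,
    Matrix.mul_smul, trace_smul, smul_eq_mul,
    trace_pairMatrix_mul_pairMatrix_left hτ hkl hkl' hll', blockUnit_mul_blockUnit, ite_and,
    ite_mul, mul_ite,
    apply_ite trace, trace_blockUnit_mul_samplingState, trace_zero, zero_mul,
    mul_zero, Finset.sum_ite_eq', Finset.mem_univ, if_true, Finset.sum_ite_irrel,
    Finset.sum_const_zero]
  refine Finset.sum_congr rfl fun i _ => ?_
  rw [Finset.sum_comm]
  conv_lhs => enter [2, c]; rw [Finset.sum_comm]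
  rw [Finset.sum_comm]
  simp only [trace, diag_apply]
  rw [Finset.mul_sum]
  refine Finset.sum_congr rfl fun a _ => ?_
  rw [mul_apply, Finset.mul_sum]
  refine Finset.sum_congr rfl fun c _ => ?_
  rw [weightedState_apply _ _ _ _ c a, Finset.mul_sum, Finset.mul_sum]
  refine Finset.sum_congr rfl fun j _ => ?_
  rw [mul_apply, Finset.sum_comm, Finset.mul_sum, Finset.sum_mul, Finset.mul_sum]
  refine Finset.sum_congr rfl fun b _ => ?_
  rw [weightedState_apply, Finset.mul_sum, Finset.mul_sum, Finset.sum_mul, Finset.mul_sum]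
  refine Finset.sum_congr rfl fun j' _ => ?_
  push_cast
  ring

end CollisionSwap

/-! ### The spread of a collection and its values in the two cases. -/

section Collections

variable {N d : ℕ}

/-- The average state `∑ i, p i ρ i` of a collection. -/
def meanState (p : Fin N → ℝ) (ρ : Fin N → Matrix (Fin d) (Fin d) ℂ) : Matrix (Fin d) (Fin d) ℂ :=
  ∑ i, (p i : ℂ) • ρ i

/-- The mean squared Hilbert–Schmidt distance `∑ i, p i ‖ρ i - ∑ j, p j ρ j‖₂²` of the states of a
collection to their average. -/
def spread (p : Fin N → ℝ) (ρ : Fin N → Matrix (Fin d) (Fin d) ℂ) : ℝ :=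
  ∑ i, p i * ((ρ i - meanState p ρ) * (ρ i - meanState p ρ)).trace.re

/-- The kernel `δ i j / p i - 1`, for which the weighted swap is an unbiased estimator of the
spread. -/
noncomputable def spreadKernel (p : Fin N → ℝ) (i j : Fin N) : ℝ :=
  (if i = j then (p i)⁻¹ else 0) - 1

variable {p : Fin N → ℝ} {ρ : Fin N → Matrix (Fin d) (Fin d) ℂ}

theorem spreadKernel_comm (i j : Fin N) : spreadKernel p i j = spreadKernel p j i := by
  unfold spreadKernel
  split_ifs <;> simp_all

/-- The weights are `p j * g i j = δ i j - p j`, so the kernel centres the collection at its mean.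
-/
theorem weightedState_spreadKernel (hp : ∀ i, 0 < p i) (i : Fin N) :
    weightedState p (spreadKernel p) ρ i = ρ i - meanState p ρ := by
  have : ∀ j, ((p j * spreadKernel p i j : ℝ) : ℂ) • ρ j
      = (if i = j then ρ j else 0) - (p j : ℂ) • ρ j := by
    intro j
    unfold spreadKernel
    split_ifs with h
    · subst h
      rw [mul_sub, mul_inv_cancel₀ (hp i).ne', mul_one, Complex.ofReal_sub, sub_smul]
      simp
    · simp
  simp only [weightedState, meanState, this, Finset.sum_sub_distrib, Finset.sum_ite_eq,
    Finset.mem_univ, if_true]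

/-- The factor `1 / p i` squared is offset by `p i * p i` on the diagonal, which makes the sum
independent of `p`; hence a sample size uniform in `p`. -/
theorem sum_mul_mul_spreadKernel_sq (hp : ∀ i, 0 < p i) (hsum : ∑ i, p i = 1) :
    ∑ i, ∑ j, p i * p j * spreadKernel p i j ^ 2 = N - 1 := by
  have : ∀ i j, p i * p j * spreadKernel p i j ^ 2
      = p i * p j + if i = j then 1 - 2 * p i else 0 := by
    intro i j
    unfold spreadKernel
    split_ifs with h
    · subst h
      have := (hp i).ne'
      field_simp
      ring
    · ring
  simp only [this, Finset.sum_add_distrib, ← Finset.mul_sum, hsum, Finset.sum_ite_eq,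
    Finset.mem_univ, if_true, Finset.sum_sub_distrib, Finset.sum_const, Finset.card_univ,
    Fintype.card_fin, mul_one, nsmul_eq_mul]
  ring

theorem sum_smul_sub_meanState (hsum : ∑ i, p i = 1) :
    ∑ i, (p i : ℂ) • (ρ i - meanState p ρ) = 0 := by
  simp only [smul_sub, Finset.sum_sub_distrib, ← Finset.sum_smul]
  rw [← Complex.ofReal_sum, hsum, Complex.ofReal_one, one_smul, meanState, sub_self]

theorem sum_mul_trace_mul_sub_meanState (hsum : ∑ i, p i = 1) :
    (∑ i, (p i : ℂ) * (ρ i * (ρ i - meanState p ρ)).trace).re = spread p ρ := by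
  have h : ∑ i, (p i : ℂ) * (meanState p ρ * (ρ i - meanState p ρ)).trace = 0 := by
    have := congrArg (fun X => (meanState p ρ * X).trace) (sum_smul_sub_meanState (ρ := ρ) hsum)
    simpa [Finset.mul_sum, trace_sum] using this
  have h' : ∑ i, (p i : ℂ) * (ρ i * (ρ i - meanState p ρ)).trace
      = ∑ i, (p i : ℂ) * ((ρ i - meanState p ρ) * (ρ i - meanState p ρ)).trace := by
    rw [← sub_eq_zero, ← h, ← Finset.sum_sub_distrib]
    refine Finset.sum_congr rfl fun i _ => ?_
    rw [← mul_sub, ← trace_sub, ← Matrix.sub_mul, sub_sub_cancel]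
  rw [h', spread, Complex.re_sum]
  simp only [Complex.re_ofReal_mul]

theorem isDensityMatrix_meanState (hp : ∀ i, 0 < p i) (hsum : ∑ i, p i = 1)
    (hρ : ∀ i, IsDensityMatrix (ρ i)) : IsDensityMatrix (meanState p ρ) := by
  constructor
  · exact posSemidef_sum _ fun i _ => (hρ i).posSemidef.smul (by exact_mod_cast (hp i).le)
  · simp only [meanState, trace_sum, trace_smul, (hρ _).trace_eq_one, mul_one, smul_eq_mul]
    exact_mod_cast hsum

theorem isHermitian_sub_meanState (hp : ∀ i, 0 < p i) (hsum : ∑ i, p i = 1)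
    (hρ : ∀ i, IsDensityMatrix (ρ i)) (i : Fin N) : (ρ i - meanState p ρ).IsHermitian :=
  (hρ i).posSemidef.isHermitian.sub
    (isDensityMatrix_meanState hp hsum hρ).posSemidef.isHermitian

theorem trace_sub_meanState_sq_nonneg (hp : ∀ i, 0 < p i) (hsum : ∑ i, p i = 1)
    (hρ : ∀ i, IsDensityMatrix (ρ i)) (i : Fin N) :
    0 ≤ ((ρ i - meanState p ρ) * (ρ i - meanState p ρ)).trace.re := by
  have := trace_conjTranspose_mul_self_re (ρ i - meanState p ρ)
  rw [(isHermitian_sub_meanState hp hsum hρ i).eq] at this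
  rw [this]
  positivity

theorem spread_nonneg (hp : ∀ i, 0 < p i) (hsum : ∑ i, p i = 1)
    (hρ : ∀ i, IsDensityMatrix (ρ i)) : 0 ≤ spread p ρ :=
  Finset.sum_nonneg fun i _ =>
    mul_nonneg (hp i).le (trace_sub_meanState_sq_nonneg hp hsum hρ i)

/-- The spread equals `∑ p i Tr(ρ i²) - Tr(m²)` with `m` the mean state, and purities are at most
one. -/
theorem spread_le_one (hp : ∀ i, 0 < p i) (hsum : ∑ i, p i = 1)
    (hρ : ∀ i, IsDensityMatrix (ρ i)) : spread p ρ ≤ 1 := by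
  have hm : 0 ≤ (meanState p ρ * meanState p ρ).trace.re := by
    have := trace_conjTranspose_mul_self_re (meanState p ρ)
    rw [(isDensityMatrix_meanState hp hsum hρ).posSemidef.isHermitian.eq] at this
    rw [this]
    positivity
  have h : ∑ i, (p i : ℂ) * (ρ i * meanState p ρ).trace
      = (meanState p ρ * meanState p ρ).trace := by
    conv_rhs => enter [1, 1]; rw [meanState]
    simp [Finset.sum_mul, trace_sum]
  rw [← sum_mul_trace_mul_sub_meanState hsum]
  simp only [trace_sub, mul_sub, Finset.sum_sub_distrib, h, Complex.sub_re,
    Complex.re_sum, Complex.re_ofReal_mul]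
  have : ∑ i, p i * (ρ i * ρ i).trace.re ≤ ∑ i, p i := Finset.sum_le_sum fun i _ =>
    mul_le_of_le_one_right (hp i).le (hρ i).trace_mul_self_le_one
  linarith

theorem CaseA.spread_eq_zero (hsum : ∑ i, p i = 1) (h : CaseA ρ) : spread p ρ = 0 := by
  refine Finset.sum_eq_zero fun i _ => ?_
  have : meanState p ρ = ρ i := by
    simp only [meanState, h _ i, ← Finset.sum_smul]
    rw [← Complex.ofReal_sum, hsum, Complex.ofReal_one, one_smul]
  rw [this]
  simp

theorem CaseB.lt_mul_spread {ε : ℝ} (hε : 0 < ε) (hp : ∀ i, 0 < p i) (hsum : ∑ i, p i = 1)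
    (hρ : ∀ i, IsDensityMatrix (ρ i)) (h : CaseB p ε ρ) : 4 * ε ^ 2 < d * spread p ρ := by
  have h1 := h _ (isDensityMatrix_meanState hp hsum hρ)
  set D : Fin N → ℝ := fun i => traceDist (ρ i) (meanState p ρ)
  have h2 : (∑ i, p i * D i) ^ 2 ≤ ∑ i, p i * D i ^ 2 := by
    -- Jensen for the weights `p`, as Cauchy–Schwarz for `√(p i)` and `√(p i) * D i` with `∑ p i =
    -- 1`.
    have := Finset.sum_mul_sq_le_sq_mul_sq Finset.univ (fun i => √(p i)) fun i => √(p i) * D i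
    simpa only [← mul_assoc, mul_pow, Real.mul_self_sqrt (hp _).le, Real.sq_sqrt (hp _).le, hsum,
      one_mul] using this
  have h3 : ∑ i, p i * D i ^ 2 ≤ d * spread p ρ / 4 := by
    rw [spread, Finset.mul_sum, Finset.sum_div]
    refine Finset.sum_le_sum fun i _ => ?_
    have h4 := traceNorm_sq_le (ρ i - meanState p ρ)
    rw [(isHermitian_sub_meanState hp hsum hρ i).eq, Fintype.card_fin] at h4
    have := mul_le_mul_of_nonneg_left h4 (hp i).le
    simp only [D, traceDist, div_pow]
    linarith
  have h5 : ε ^ 2 < (∑ i, p i * D i) ^ 2 := pow_lt_pow_left₀ h1 hε.le two_ne_zero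
  linarith

end Collections

/-! ### Mean and variance of the swap statistic. -/

section Statistic

variable {N d M : ℕ}

/-- The swap statistic `∑ k ≠ l, ∑ i j, g i j |i j⟩⟨i j| ⊗ SWAP`. -/
def swapStatistic (M : ℕ) (g : Fin N → Fin N → ℝ) :
    Matrix (Fin M → Fin N × Fin d) (Fin M → Fin N × Fin d) ℂ :=
  ∑ k, ∑ l, if k = l then 0 else weightedSwap g k l

theorem isHermitian_swapStatistic (M : ℕ) (g : Fin N → Fin N → ℝ) :
    (swapStatistic M g : Matrix (Fin M → Fin N × Fin d) _ ℂ).IsHermitian := by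
  unfold swapStatistic IsHermitian
  simp only [conjTranspose_sum]
  refine Finset.sum_congr rfl fun k _ => Finset.sum_congr rfl fun l _ => ?_
  split_ifs with h
  · simp
  · exact isHermitian_weightedSwap h

variable {p : Fin N → ℝ} {ρ : Fin N → Matrix (Fin d) (Fin d) ℂ}

theorem trace_spreadSwap_mul (hp : ∀ i, 0 < p i) (hsum : ∑ i, p i = 1)
    (hρ : ∀ i, IsDensityMatrix (ρ i)) {k l : Fin M} (hkl : k ≠ l) :
    (weightedSwap (spreadKernel p) k l * tensorPower M (samplingState p ρ)).trace.re
      = spread p ρ := by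
  rw [trace_weightedSwap_mul (isDensityMatrix_samplingState hp hsum hρ).trace_eq_one hkl]
  simp only [weightedState_spreadKernel hp, sum_mul_trace_mul_sub_meanState hsum]

theorem trace_swapStatistic_mul (hp : ∀ i, 0 < p i) (hsum : ∑ i, p i = 1)
    (hρ : ∀ i, IsDensityMatrix (ρ i)) :
    (swapStatistic M (spreadKernel p) * tensorPower M (samplingState p ρ)).trace.re
      = M * (M - 1) * spread p ρ := by
  have : ∀ k l : Fin M, ((if k = l then 0 else weightedSwap (spreadKernel p) k l)
      * tensorPower M (samplingState p ρ)).trace.re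
      = spread p ρ - if k = l then spread p ρ else 0 := by
    intro k l
    split_ifs with h
    · simp
    · rw [trace_spreadSwap_mul hp hsum hρ h, sub_zero]
  simp only [swapStatistic, Matrix.sum_mul, trace_sum, Complex.re_sum, this,
    Finset.sum_sub_distrib, Finset.sum_ite_eq, Finset.mem_univ, if_true, Finset.sum_const,
    Finset.card_univ, Fintype.card_fin, nsmul_eq_mul]
  ring

theorem trace_spreadSwap_mul_spreadSwap_left_le (hp : ∀ i, 0 < p i) (hsum : ∑ i, p i = 1)
    (hρ : ∀ i, IsDensityMatrix (ρ i)) {k l l' : Fin M} (hkl : k ≠ l) (hkl' : k ≠ l')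
    (hll' : l ≠ l') :
    (weightedSwap (spreadKernel p) k l * weightedSwap (spreadKernel p) k l'
      * tensorPower M (samplingState p ρ)).trace.re ≤ spread p ρ := by
  rw [trace_weightedSwap_mul_weightedSwap_left
    (isDensityMatrix_samplingState hp hsum hρ).trace_eq_one hkl hkl' hll', Complex.re_sum, spread]
  refine Finset.sum_le_sum fun i _ => ?_
  rw [Complex.re_ofReal_mul, weightedState_spreadKernel hp]
  exact mul_le_mul_of_nonneg_left
    ((hρ i).trace_mul_sq_le (isHermitian_sub_meanState hp hsum hρ i)) (hp i).le

theorem trace_spreadSwap_mul_spreadSwap_same_le (hp : ∀ i, 0 < p i) (hsum : ∑ i, p i = 1)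
    (hρ : ∀ i, IsDensityMatrix (ρ i)) {k l : Fin M} (hkl : k ≠ l) :
    (weightedSwap (spreadKernel p) k l * weightedSwap (spreadKernel p) k l
      * tensorPower M (samplingState p ρ)).trace.re ≤ (N : ℝ) := by
  rw [trace_weightedSwap_mul_weightedSwap_same
    (isDensityMatrix_samplingState hp hsum hρ).trace_eq_one (fun i => (hρ i).trace_eq_one) hkl]
  simp only [Complex.re_sum, Complex.ofReal_re]
  rw [sum_mul_mul_spreadKernel_sq hp hsum]
  linarith

/-- The covariance of two weighted swaps. -/
theorem trace_spreadSwap_mul_spreadSwap_le (hp : ∀ i, 0 < p i) (hsum : ∑ i, p i = 1)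
    (hρ : ∀ i, IsDensityMatrix (ρ i)) {k l k' l' : Fin M} (hkl : k ≠ l) (hkl' : k' ≠ l') :
    (weightedSwap (spreadKernel p) k l * weightedSwap (spreadKernel p) k' l'
      * tensorPower M (samplingState p ρ)).trace.re ≤ spread p ρ ^ 2
        + N * ((if k = k' then if l = l' then 1 else 0 else 0)
          + if k = l' then if l = k' then 1 else 0 else 0)
        + spread p ρ * ((if k = k' then 1 else 0) + (if k = l' then 1 else 0)
          + (if l = k' then 1 else 0) + if l = l' then 1 else 0) := by
  have hs := spread_nonneg hp hsum hρ
  have hs2 := sq_nonneg (spread p ρ)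
  have hN : (0 : ℝ) ≤ N := N.cast_nonneg
  have same := fun {k l : Fin M} (h : k ≠ l) =>
    trace_spreadSwap_mul_spreadSwap_same_le hp hsum hρ h
  have left := fun {k l l' : Fin M} (h : k ≠ l) (h' : k ≠ l') (h'' : l ≠ l') =>
    trace_spreadSwap_mul_spreadSwap_left_le hp hsum hρ h h' h''
  have comm := fun {k l : Fin M} (h : k ≠ l) =>
    weightedSwap_comm (d := d) (spreadKernel_comm (p := p)) h
  -- Cases follow the overlap pattern of the two pairs. Symmetry of the weighted swap moves any
  -- shared copy to the first slot; the unused indicator terms on the right are nonnegative.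
  by_cases h1 : k = k'
  · subst h1
    by_cases h4 : l = l'
    · subst h4
      have := same hkl
      simp only [if_true]
      split_ifs <;> nlinarith
    · have := left hkl hkl' h4
      simp only [if_true, if_neg h4]
      split_ifs <;> nlinarith
  by_cases h2 : k = l'
  · subst h2
    rw [comm hkl']
    by_cases h3 : l = k'
    · subst h3
      have := same hkl
      simp only [if_true, if_neg h1]
      split_ifs <;> nlinarith
    · have := left hkl hkl'.symm h3
      simp only [if_true, if_neg h1, if_neg h3]
      split_ifs <;> nlinarith
  by_cases h3 : l = k'
  · subst h3
    rw [comm hkl]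
    have := left hkl.symm hkl' h2
    simp only [if_true, if_neg h1, if_neg h2]
    split_ifs <;> nlinarith
  by_cases h4 : l = l'
  · subst h4
    rw [comm hkl, comm hkl']
    have := left hkl.symm hkl'.symm h1
    simp only [if_true, if_neg h1, if_neg h2, if_neg h3]
    nlinarith
  rw [trace_weightedSwap_mul_weightedSwap_disjoint
    (isDensityMatrix_samplingState hp hsum hρ).trace_eq_one hkl hkl' h1 h2 h3 h4, Complex.mul_re,
    trace_spreadSwap_mul hp hsum hρ hkl, trace_spreadSwap_mul hp hsum hρ hkl',
    trace_weightedSwap_mul (isDensityMatrix_samplingState hp hsum hρ).trace_eq_one hkl,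
    trace_weightedSwap_mul (isDensityMatrix_samplingState hp hsum hρ).trace_eq_one hkl']
  simp only [if_neg h1, if_neg h2, if_neg h3, if_neg h4]
  -- Both factors are the same complex number `z` with `Re z = spread`, and `Re (z²) = (Re z)² - (Im
  -- z)²`, so `z` need not be shown real.
  nlinarith [mul_self_nonneg (∑ i, (p i : ℂ)
    * (ρ i * weightedState p (spreadKernel p) ρ i).trace).im]

/-- The variance of the swap statistic. -/
theorem trace_swapStatistic_sq_mul_le (hp : ∀ i, 0 < p i) (hsum : ∑ i, p i = 1)
    (hρ : ∀ i, IsDensityMatrix (ρ i)) :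
    (swapStatistic M (spreadKernel p) * swapStatistic M (spreadKernel p)
      * tensorPower M (samplingState p ρ)).trace.re
      ≤ (M * (M - 1) * spread p ρ) ^ 2 + 2 * N * M ^ 2 + 4 * M ^ 3 * spread p ρ := by
  have hs := spread_nonneg hp hsum hρ
  -- The bound is phrased for all quadruples, including `k = l`, so that the sums factorise: the
  -- first term gives exactly the squared mean, the double coincidences `2M²`, the single ones
  -- `4M³`.
  have key : ∀ k l k' l' : Fin M,
      ((if k = l then 0 else weightedSwap (spreadKernel p) k l)
        * (if k' = l' then 0 else weightedSwap (spreadKernel p) k' l')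
        * tensorPower M (samplingState p ρ)).trace.re
      ≤ (spread p ρ - if k = l then spread p ρ else 0)
          * (spread p ρ - if k' = l' then spread p ρ else 0)
        + N * ((if k = k' then if l = l' then 1 else 0 else 0)
          + if k = l' then if l = k' then 1 else 0 else 0)
        + spread p ρ * ((if k = k' then 1 else 0) + (if k = l' then 1 else 0)
          + (if l = k' then 1 else 0) + if l = l' then 1 else 0) := by
    intro k l k' l'
    by_cases h : k = l
    · simp only [if_pos h, trace_zero, Complex.zero_re, sub_self, zero_mul,
        zero_add]
      positivity
    by_cases h' : k' = l'
    · simp only [if_pos h', Matrix.zero_mul, trace_zero, Complex.zero_re, sub_self,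
        mul_zero, zero_add]
      positivity
    rw [if_neg h, if_neg h', if_neg h, if_neg h', sub_zero, ← sq]
    exact trace_spreadSwap_mul_spreadSwap_le hp hsum hρ h h'
  have hexp : (swapStatistic M (spreadKernel p) * swapStatistic M (spreadKernel p)
      * tensorPower M (samplingState p ρ)).trace.re = ∑ k, ∑ l, ∑ k', ∑ l',
      ((if k = l then 0 else weightedSwap (spreadKernel p) k l)
        * (if k' = l' then 0 else weightedSwap (spreadKernel p) k' l')
        * tensorPower M (samplingState p ρ)).trace.re := by
    rw [swapStatistic, Finset.sum_mul_sum]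
    simp only [Finset.sum_mul_sum, Matrix.sum_mul, trace_sum, Complex.re_sum]
    exact Finset.sum_congr rfl fun k _ => Finset.sum_comm
  rw [hexp]
  refine (Finset.sum_le_sum fun k _ => Finset.sum_le_sum fun l _ => Finset.sum_le_sum fun k' _ =>
    Finset.sum_le_sum fun l' _ => key k l k' l').trans (le_of_eq ?_)
  simp only [Finset.sum_add_distrib, ← Finset.mul_sum, ← Finset.sum_mul, Finset.sum_sub_distrib,
    Finset.sum_ite_eq, Finset.sum_ite_irrel, Finset.sum_const_zero,
    Finset.mem_univ, if_true, Finset.sum_const, Finset.card_univ, Fintype.card_fin, nsmul_eq_mul]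
  ring

end Statistic

/-! ### Choice of constants and the final Chebyshev argument. -/

theorem theorem1 :
    ∃ C : ℝ, 0 < C ∧
      ∀ (N d : ℕ) (ε : ℝ), 0 < ε →
        ∃ M₀ : ℕ, (M₀ : ℝ) ≤ C * (√(N : ℝ) * (d : ℝ) / ε ^ 2) ∧
          ∀ p : Fin N → ℝ, (∀ i, 0 < p i) → ∑ i, p i = 1 →
            ∀ M : ℕ, M₀ ≤ M →
              ∃ T : TwoOutcomePOVM (Fin M → Fin N × Fin d),
                ∀ ρ : Fin N → Matrix (Fin d) (Fin d) ℂ, (∀ i, IsDensityMatrix (ρ i)) →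
                  (CaseA ρ →
                    2 / 3 < T.acceptProb (tensorPower M (samplingState p ρ))) ∧
                  (CaseB p ε ρ →
                    T.acceptProb (tensorPower M (samplingState p ρ)) < 1 / 3) := by
  -- The sample size is `⌈100 Q⌉` with `Q = √N d/ε²`; when `Q ≥ 1`, the rounding costs at most one
  -- more `Q`.
  refine ⟨101, by norm_num, fun N d ε hε => ?_⟩
  have hε2 : 0 < ε ^ 2 := by positivity
  rcases lt_or_ge (√(N : ℝ) * d / ε ^ 2) 1 with hlt | hge
  -- If `Q < 1`, always accepting works: Case B would give `4ε² < d * spread ≤ d ≤ √N d < ε²`.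
  · refine ⟨0, by rw [Nat.cast_zero]; positivity, fun p hp hsum M _ =>
      ⟨⟨1, 0, PosSemidef.one, PosSemidef.zero, add_zero 1⟩, fun ρ hρ =>
        ⟨fun _ => ?_, fun hB => ?_⟩⟩⟩
    · rw [TwoOutcomePOVM.acceptProb, Matrix.one_mul,
        ((isDensityMatrix_samplingState hp hsum hρ).tensorPower M).trace_eq_one]
      norm_num
    · exfalso
      have h1 := hB.lt_mul_spread hε hp hsum hρ
      have h2 := mul_le_mul_of_nonneg_left (spread_le_one hp hsum hρ) d.cast_nonneg
      have hN : (1 : ℝ) ≤ √N := by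
        rw [Real.one_le_sqrt, Nat.one_le_cast]
        rcases N.eq_zero_or_pos with rfl | h
        · simp at hsum
        · exact h
      rw [div_lt_one hε2] at hlt
      have := mul_le_mul_of_nonneg_right hN (d.cast_nonneg (α := ℝ))
      linarith
  · set Q := √(N : ℝ) * d / ε ^ 2 with hQ
    refine ⟨⌈100 * Q⌉₊, ?_, fun p hp hsum M hM => ?_⟩
    · have := Nat.ceil_lt_add_one (a := 100 * Q) (by positivity)
      linarith
    have hMQ : 100 * Q ≤ M := Nat.ceil_le.mp hM
    have hM2 : (2 : ℝ) ≤ M := by linarith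
    have hd : (0 : ℝ) < d := by
      rcases d.eq_zero_or_pos with rfl | h
      · simp [hQ] at hge
        linarith
      · exact_mod_cast h
    have hN : (1 : ℝ) ≤ √N := by
      rw [Real.one_le_sqrt, Nat.one_le_cast]
      rcases N.eq_zero_or_pos with rfl | h
      · simp at hsum
      · exact h
    have hNsq : √(N : ℝ) ^ 2 = N := Real.sq_sqrt N.cast_nonneg
    -- Midway between the spread `0` of Case A and the lower bound `4ε²/d` of Case B. Then `Q * θ =
    -- 2√N`, so `d` and `ε` cancel in `M * θ`.
    set θ := 2 * ε ^ 2 / d with hθ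
    have hθ0 : 0 < θ := by positivity
    have hMθ : 200 * √(N : ℝ) ≤ M * θ := by
      have : Q * θ = 2 * √(N : ℝ) := by rw [hQ, hθ]; field_simp
      nlinarith
    have hK : (M : ℝ) ^ 2 / 2 ≤ M * (M - 1) := by nlinarith
    refine ⟨thresholdPOVM (isHermitian_swapStatistic M (spreadKernel p)) (M * (M - 1) * θ),
      fun ρ hρ => ?_⟩
    have hτ := (isDensityMatrix_samplingState hp hsum hρ).tensorPower M
    have hvar := trace_swapStatistic_sq_mul_le (M := M) hp hsum hρ
    have hmean := trace_swapStatistic_mul (M := M) hp hsum hρ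
    have hMpos : (0 : ℝ) < M := by linarith
    refine ⟨fun hA => ?_, fun hB => ?_⟩
    · have h := one_sub_acceptProb_thresholdPOVM_le
        (isHermitian_swapStatistic M (spreadKernel p)) hτ
        (θ := M * (M - 1) * θ) (mul_nonneg (le_trans (by positivity) hK) hθ0.le)
      set P := (thresholdPOVM (isHermitian_swapStatistic M (spreadKernel p))
        (M * (M - 1) * θ)).acceptProb (tensorPower M (samplingState p ρ))
      rw [hA.spread_eq_zero hsum] at hvar
      -- With zero spread, a rejection probability of at least `1/3` would give `(Mθ)²/12 ≤ 2N`,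
      -- against `(Mθ)² ≥ 40000 N`.
      by_contra! hP
      have h1 : ((M : ℝ) ^ 2 / 2 * θ) ^ 2 ≤ (M * (M - 1) * θ) ^ 2 := by gcongr
      have h2 : 1 / 3 * ((M : ℝ) ^ 2 / 2 * θ) ^ 2 ≤ 2 * N * M ^ 2 := by
        have : 1 / 3 * (M * (M - 1) * θ) ^ 2 ≤ (1 - P) * (M * (M - 1) * θ) ^ 2 := by
          gcongr
          linarith
        linarith
      have h3 : (200 * √(N : ℝ)) ^ 2 ≤ (M * θ) ^ 2 := by gcongr
      have h4 : (M : ℝ) ^ 2 * ((M * θ) ^ 2 / 12 - 2 * N) ≤ 0 := by linarith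
      have h5 : (M * θ) ^ 2 / 12 - 2 * N ≤ 0 := by
        by_contra! h6
        have := mul_pos (pow_pos hMpos 2) h6
        linarith
      nlinarith
    · have hs := hB.lt_mul_spread hε hp hsum hρ
      set μ := spread p ρ with hμ
      have hθμ : 2 * θ ≤ μ := by
        rw [hθ, ← mul_div_assoc, div_le_iff₀ hd]
        linarith
      have hK0 : 0 ≤ (M : ℝ) * (M - 1) := le_trans (by positivity) hK
      have h := acceptProb_thresholdPOVM_mul_le
        (isHermitian_swapStatistic M (spreadKernel p)) hτ
        (θ := M * (M - 1) * θ) (mul_le_mul_of_nonneg_left (by linarith) hK0) hmean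
      set P := (thresholdPOVM (isHermitian_swapStatistic M (spreadKernel p))
        (M * (M - 1) * θ)).acceptProb (tensorPower M (samplingState p ρ))
      rw [← mul_sub] at h
      by_contra! hP
      -- From `2θ ≤ μ`, the gap `μ - θ` is at least `μ / 2`.
      have h1 : ((M : ℝ) ^ 2 / 2 * (μ / 2)) ^ 2 ≤ (M * (M - 1) * (μ - θ)) ^ 2 := by
        have : 0 ≤ μ / 2 := by linarith
        gcongr
        linarith
      have h2 : 1 / 3 * ((M : ℝ) ^ 2 / 2 * (μ / 2)) ^ 2 ≤ 2 * N * M ^ 2 + 4 * M ^ 3 * μ := by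
        have : 1 / 3 * (M * (M - 1) * (μ - θ)) ^ 2 ≤ P * (M * (M - 1) * (μ - θ)) ^ 2 := by
          gcongr
        linarith
      -- After division by `M²`, everything depends on `x`: the assumption becomes `x²/48 ≤ 2N +
      -- 4x`, while `x ≥ 400√N ≥ 400` makes the right side at most `x²/80000 + x²/100`.
      set x := (M : ℝ) * μ with hx
      have h3 : 400 * √(N : ℝ) ≤ x := by
        have := mul_le_mul_of_nonneg_left hθμ hMpos.le
        linarith
      have h4 : (M : ℝ) ^ 2 * (x ^ 2 / 48 - 2 * N - 4 * x) ≤ 0 := by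
        rw [hx]
        linarith
      have h5 : x ^ 2 / 48 - 2 * N - 4 * x ≤ 0 := by
        by_contra! h6
        have := mul_pos (pow_pos hMpos 2) h6
        linarith
      have h6 : 160000 * (N : ℝ) ≤ x ^ 2 := by
        have := pow_le_pow_left₀ (by positivity) h3 2
        rw [mul_pow, hNsq] at this
        linarith
      have h7 : 400 * x ≤ x * x := mul_le_mul_of_nonneg_right (by linarith) (by linarith)
      linarith
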